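/- Let $P_0\neq P_1$ be mutually absolutely continuous probability measures on $\mathbb R$ that have probability densities, let $\pi_0\in[0,1]$ and $c>0$. Let $s=0,1,2,\dots$ index independent sequences $(Y^s_k)_{k\ge 1}$: each sequence, independently of the others, is with probability $\pi_0$ i.i.d. $\sim P_1$ (its label is $1$) and with probability $1-\pi_0$ i.i.d. $\sim P_0$ (its label is $0$). Scanning stage. The sequences are grouped into pairs $(2n,2n+1)$, $n=0,1,\dots$. At each time $k\ge1$ the observer sees $Z_k=Y^{2n_k}_k+Y^{2n_k+1}_k$, where $n_1=0$ and $n_{k+1}=n_k+\phi_k$. Here $\boldsymbol\phi=(\phi_1,\phi_2,\dots)$ is a switching rule: $\phi_k\in\{0,1\}$ is $\mathcal F_k$-measurable, with $\mathcal F_k=\sigma(Z_1,\dots,Z_k)$ and $\mathcal F_0$ trivial. The stage ends at an $(\mathcal F_k)_{k\ge0}$-stopping time $\tau_0$ with values in $\{0,1,\dots\}\cup\{\infty\}$. Its final pair is pair number $n_{\tau_0}$, with $n_0=0$. Refinement stage. One then observes $X_j=Y^{2n_{\tau_0}}_{\tau_0+j}$, $j\ge1$. Let $\mathcal G_j=\sigma(Z_1,\dots,Z_{\tau_0},X_1,\dots,X_j)=\mathcal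 F_{\tau_0}\vee\sigma(X_1,\dots,X_j)$, and let $\tau_1$ be a stopping time of $(\mathcal G_j)_{j\ge0}$ with values in $\{0,1,\dots\}\cup\{\infty\}$. For $a,b\in\{0,1\}$ let $r^{a,b}_j$ be the conditional probability given $\mathcal G_j$ that the sequences $2n_{\tau_0}$ and $2n_{\tau_0}+1$ have labels $a$ and $b$, respectively. Put $q_{1,j}=r^{1,1}_j+r^{1,0}_j$ and $q_{2,j}=r^{1,1}_j+r^{0,1}_j$. A cost is $+\infty$ wherever a stopping time in it is infinite. Define $$w_0=\inf_{\tau_0,\boldsymbol\phi,\tau_1}\mathbb E\big[c(\tau_0+\tau_1)+1-\max\{q_{1,\tau_1},q_{2,\tau_1}\}\big],$$ $$v(\tau_0,\boldsymbol\phi)=\operatorname*{ess\,inf}_{\tau_1}\mathbb E\big[c\tau_1+1-\max\{q_{1,\tau_1},q_{2,\tau_1}\}\,\big|\,\mathcal F_{\tau_0}\big],$$ $$u_0=\inf_{\tau_0,\boldsymbol\phi}\mathbb E\big[c\tau_0+v(\tau_0,\boldsymbol\phi)\big].$$ Then $w_0=u_0$. -/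

import Mathlib

open MeasureTheory ProbabilityTheory
open scoped ENNReal

noncomputable section

namespace QuickestSearch

/-! ### Essential infimum of a (possibly uncountable) family -/

/-- `v` is an essential infimum under `P` of the family `Φ` of `[0,∞]`-valued random variables:
a random variable that is almost surely below every member of the family, and almost surely
above every other such random variable. It is unique up to `P`-null sets. -/
structure IsEssInf {Ω : Type*} [MeasurableSpace Ω] {ι : Type*} (P : Measure Ω)
    (Φ : ι → Ω → ℝ≥0∞) (v : Ω → ℝ≥0∞) : Prop where
  measurable : Measurable v
  le : ∀ i, v ≤ᵐ[P] Φ i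
  greatest : ∀ u : Ω → ℝ≥0∞, Measurable u → (∀ i, u ≤ᵐ[P] Φ i) → u ≤ᵐ[P] v

theorem exists_isEssInf {Ω : Type*} [MeasurableSpace Ω] {ι : Type*} (P : Measure Ω)
    [IsFiniteMeasure P] (Φ : ι → Ω → ℝ≥0∞) (hΦ : ∀ i, Measurable (Φ i)) :
    ∃ v, IsEssInf P Φ v := by
  rcases isEmpty_or_nonempty ι with hι | hι
  · exact ⟨fun _ => ⊤, measurable_const, fun i => hι.elim i,
      fun u _ _ => Filter.Eventually.of_forall fun _ => le_top⟩
  let e : ℝ≥0∞ → ℝ≥0∞ := fun x => (x⁻¹ + 1)⁻¹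
  have he_meas : Measurable e := by fun_prop
  have he_mono : ∀ x y, e x ≤ e y ↔ x ≤ y := fun x y => by
    simp only [e]
    rw [ENNReal.inv_le_inv, ENNReal.add_le_add_iff_right ENNReal.one_ne_top,
      ENNReal.inv_le_inv]
  have he_le : ∀ x, e x ≤ 1 := fun x => by
    simp only [e]
    rw [ENNReal.inv_le_one]
    exact le_add_self
  let I : (ℕ → ι) → ℝ≥0∞ := fun a => ∫⁻ ω, e (⨅ n, Φ (a n) ω) ∂P
  obtain ⟨s, -, hs, hmem⟩ := exists_seq_tendsto_sInf (Set.range_nonempty I)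
    (OrderBot.bddBelow _)
  choose a ha using hmem
  let b : ℕ → ι := fun n => a n.unpair.1 n.unpair.2
  have hb : ∀ k ω, ⨅ n, Φ (b n) ω ≤ ⨅ n, Φ (a k n) ω := fun k ω =>
    le_iInf fun n => (iInf_le _ (Nat.pair k n)).trans (by simp [b])
  have hbI : I b ≤ sInf (Set.range I) := by
    refine ge_of_tendsto' hs fun k => ?_
    rw [← ha k]
    exact lintegral_mono fun ω => (he_mono _ _).2 (hb k ω)
  have hmeas : Measurable fun ω => ⨅ n, Φ (b n) ω := Measurable.iInf fun n => hΦ _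
  refine ⟨fun ω => ⨅ n, Φ (b n) ω, hmeas, fun i => ?_, fun u _ hui => ?_⟩
  · let d : ℕ → ι := fun n => Nat.casesOn n i b
    have hd1 : ∀ ω, ⨅ n, Φ (d n) ω ≤ Φ i ω := fun ω => iInf_le _ 0
    have hd2 : ∀ ω, ⨅ n, Φ (d n) ω ≤ ⨅ n, Φ (b n) ω := fun ω =>
      le_iInf fun n => iInf_le (fun n => Φ (d n) ω) (n + 1)
    have hle : (fun ω => e (⨅ n, Φ (d n) ω)) ≤ᵐ[P] fun ω => e (⨅ n, Φ (b n) ω) :=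
      Filter.Eventually.of_forall fun ω => (he_mono _ _).2 (hd2 ω)
    have hfin : ∫⁻ ω, e (⨅ n, Φ (d n) ω) ∂P ≠ ⊤ := by
      refine ((lintegral_mono fun ω => he_le _).trans_lt ?_).ne
      simp
    have hae := ae_eq_of_ae_le_of_lintegral_le hle hfin
      (he_meas.comp hmeas).aemeasurable (hbI.trans (sInf_le ⟨d, rfl⟩))
    filter_upwards [hae] with ω hω
    exact ((he_mono _ _).1 hω.ge).trans (hd1 ω)
  · filter_upwards [ae_all_iff.2 fun n => hui (b n)] with ω hω
    exact le_iInf hω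

/-- The essential infimum of a family of `[0,∞]`-valued random variables (some version of it). -/
def essInfFamily {Ω : Type*} [MeasurableSpace Ω] {ι : Type*} (P : Measure Ω)
    [IsFiniteMeasure P] (Φ : ι → Ω → ℝ≥0∞) (hΦ : ∀ i, Measurable (Φ i)) : Ω → ℝ≥0∞ :=
  (exists_isEssInf P Φ hΦ).choose

theorem isEssInf_essInfFamily {Ω : Type*} [MeasurableSpace Ω] {ι : Type*} (P : Measure Ω)
    [IsFiniteMeasure P] (Φ : ι → Ω → ℝ≥0∞) (hΦ : ∀ i, Measurable (Φ i)) :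
    IsEssInf P Φ (essInfFamily P Φ hΦ) :=
  (exists_isEssInf P Φ hΦ).choose_spec

/-! ### The sequences -/

/-- The joint law of the label of one sequence and its samples: with probability `π₀` the label is
`true` and the samples are i.i.d. `P₁`; with probability `1 - π₀` the label is `false` and the
samples are i.i.d. `P₀`. -/
def sequenceLaw (P₀ P₁ : Measure ℝ) (π₀ : ℝ) : Measure (Bool × (ℕ → ℝ)) :=
  ENNReal.ofReal π₀ • (Measure.dirac true).prod (Measure.infinitePi fun _ : ℕ => P₁) +
    ENNReal.ofReal (1 - π₀) • (Measure.dirac false).prod (Measure.infinitePi fun _ : ℕ => P₀)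

/-- Infinitely many independent sequences on a probability space `(Ω, P)`. `H s ω = true` means
that sequence `s` is generated by `P₁` (hypothesis `H₁`), and `Y s k` is the sample of sequence `s`
at time `k`. Times are `1, 2, …`; the value `Y s 0` is never observed. -/
structure Sequences {Ω : Type*} [MeasurableSpace Ω] (P : Measure Ω) (P₀ P₁ : Measure ℝ)
    (π₀ : ℝ) where
  H : ℕ → Ω → Bool
  Y : ℕ → ℕ → Ω → ℝ
  measurable_H : ∀ s, Measurable (H s)
  measurable_Y : ∀ s k, Measurable (Y s k)
  indep : iIndepFun (fun s ω => (H s ω, fun k => Y s k ω)) P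
  law : ∀ s, P.map (fun ω => (H s ω, fun k => Y s k ω)) = sequenceLaw P₀ P₁ π₀

variable {Ω : Type*} [mΩ : MeasurableSpace Ω] {P : Measure Ω} {P₀ P₁ : Measure ℝ} {π₀ : ℝ}

/-! ### Scanning stage -/

/-- Index of the pair of sequences observed at time `k` under the switching indicators `φ`. The
first pair has index `0`, it is also the current pair at time `0`, and the observer moves from the
pair observed at time `k ≥ 1` to the next, new pair iff `φ k = 1`. -/
def pairIndex (φ : ℕ → Ω → Bool) : ℕ → Ω → ℕ
  | 0, _ => 0
  | k + 1, ω => pairIndex φ k ω + if 1 ≤ k ∧ φ k ω = true then 1 else 0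

namespace Sequences

variable (M : Sequences P P₀ P₁ π₀)

/-- The mixed observation `Z k`, the sum of the time-`k` samples of the two sequences
`2 * n` and `2 * n + 1` of the current pair `n`. -/
def mixedObs (φ : ℕ → Ω → Bool) (k : ℕ) (ω : Ω) : ℝ :=
  M.Y (2 * pairIndex φ k ω) k ω + M.Y (2 * pairIndex φ k ω + 1) k ω

/-- `F k = σ(Z 1, …, Z k)`. -/
abbrev scanSigma (φ : ℕ → Ω → Bool) (k : ℕ) : MeasurableSpace Ω :=
  ⨆ i ∈ Set.Icc 1 k, MeasurableSpace.comap (M.mixedObs φ i) inferInstance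

/-- Sequences of switching decisions, `φ k` being a `{0,1}`-valued function of `Z 1, …, Z k`. -/
structure SwitchingRule where
  φ : ℕ → Ω → Bool
  adapted : ∀ k, 1 ≤ k → Measurable[M.scanSigma φ k] (φ k)

namespace SwitchingRule

variable {M} (R : M.SwitchingRule)

theorem measurable_mixedObs_of_pairIndex {k : ℕ} (h : Measurable (pairIndex R.φ k)) :
    Measurable (M.mixedObs R.φ k) := by
  have key : ∀ f : ℕ → ℕ, Measurable fun ω => M.Y (f (pairIndex R.φ k ω)) k ω := fun f => by
    have : Measurable fun p : Ω × ℕ => M.Y (f p.2) k p.1 :=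
      measurable_from_prod_countable_left fun n => M.measurable_Y (f n) k
    exact this.comp (measurable_id.prodMk h)
  exact (key fun n => 2 * n).add (key fun n => 2 * n + 1)

theorem measurable_pairIndex (k : ℕ) : Measurable (pairIndex R.φ k) := by
  induction k using Nat.strong_induction_on with
  | _ k ih =>
    cases k with
    | zero => exact measurable_const
    | succ k =>
      have hF : M.scanSigma R.φ k ≤ mΩ := iSup₂_le fun i hi =>
        (R.measurable_mixedObs_of_pairIndex (ih i (Nat.lt_succ_of_le hi.2))).comap_le
      refine (ih k (Nat.lt_succ_self k)).add (Measurable.ite ?_ measurable_const measurable_const)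
      by_cases hk : 1 ≤ k
      · simp only [hk, true_and]
        exact ((R.adapted k hk).mono hF le_rfl) (measurableSet_singleton true)
      · simp [hk]

theorem measurable_mixedObs (k : ℕ) : Measurable (M.mixedObs R.φ k) :=
  R.measurable_mixedObs_of_pairIndex (R.measurable_pairIndex k)

/-- The filtration `F k = σ(Z 1, …, Z k)` of the scanning stage. -/
def scanFiltration : Filtration ℕ mΩ where
  seq := M.scanSigma R.φ
  mono' _ _ h := biSup_mono fun _ hi => ⟨hi.1, hi.2.trans h⟩
  le' _ := iSup₂_le fun i _ => (R.measurable_mixedObs i).comap_le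

end SwitchingRule

/-- The decisions of the scanning stage: a switching rule `φ` and a stopping time `τ₀` of the
filtration of the scanning stage (possibly `0` and possibly infinite). -/
structure ScanPolicy where
  rule : M.SwitchingRule
  τ₀ : Ω → ℕ∞
  isStoppingTime : IsStoppingTime rule.scanFiltration τ₀

namespace ScanPolicy

variable {M} (S : M.ScanPolicy)

/-- The stopped σ-algebra `F_{τ₀}`. -/
abbrev stoppedSigma : MeasurableSpace Ω := S.isStoppingTime.measurableSpace

theorem stoppedSigma_le : S.stoppedSigma ≤ mΩ := S.isStoppingTime.measurableSpace_le

/-- `τ₀` as a natural number. The value `0` where `τ₀ = ∞` is immaterial, because the cost is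
infinite there. -/
def endTime (ω : Ω) : ℕ := (S.τ₀ ω).toNat

/-- Index of the pair of sequences that enters the refinement stage. -/
def finalPair (ω : Ω) : ℕ := pairIndex S.rule.φ (S.endTime ω) ω

/-! ### Refinement stage -/

/-- `X j`, the sample at time `τ₀ + j` of the first sequence of the final pair. -/
def refineObs (j : ℕ) (ω : Ω) : ℝ := M.Y (2 * S.finalPair ω) (S.endTime ω + j) ω

theorem measurable_endTime : Measurable S.endTime :=
  (measurable_of_countable (α := WithTop ℕ) fun x => ENat.toNat x).comp S.isStoppingTime.measurable'

theorem measurable_finalPair : Measurable S.finalPair := by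
  have : Measurable fun p : Ω × ℕ => pairIndex S.rule.φ p.2 p.1 :=
    measurable_from_prod_countable_left fun n =>
      S.rule.measurable_pairIndex n
  exact this.comp (measurable_id.prodMk S.measurable_endTime)

theorem measurable_refineObs (j : ℕ) : Measurable (S.refineObs j) := by
  have : Measurable fun p : Ω × (ℕ × ℕ) => M.Y (2 * p.2.1) (p.2.2 + j) p.1 :=
    measurable_from_prod_countable_left fun n => M.measurable_Y (2 * n.1) (n.2 + j)
  exact this.comp (measurable_id.prodMk (S.measurable_finalPair.prodMk S.measurable_endTime))

/-- The filtration `G j = σ(Z 1, …, Z τ₀, X 1, …, X j)` of the refinement stage. -/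
def refineFiltration : Filtration ℕ mΩ where
  seq j := S.stoppedSigma ⊔
    ⨆ i ∈ Set.Icc 1 j, MeasurableSpace.comap (S.refineObs i) inferInstance
  mono' _ _ h := sup_le_sup_left (biSup_mono fun _ hi => ⟨hi.1, hi.2.trans h⟩) _
  le' _ := sup_le S.stoppedSigma_le (iSup₂_le fun i _ => (S.measurable_refineObs i).comap_le)

/-- The stopping times `τ₁` of the refinement stage. -/
def RefineTime : Type _ := {τ₁ : Ω → ℕ∞ // IsStoppingTime S.refineFiltration τ₁}

/-- The posterior probability, given `G j`, that the two sequences of the final pair have the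
labels `a` and `b`. -/
def r (a b : Bool) (j : ℕ) : Ω → ℝ :=
  P⟦{ω | M.H (2 * S.finalPair ω) ω = a ∧ M.H (2 * S.finalPair ω + 1) ω = b} |
    S.refineFiltration j⟧

/-- `q_{1,j} = r^{1,1}_j + r^{1,0}_j`. -/
def q₁ (j : ℕ) (ω : Ω) : ℝ := S.r true true j ω + S.r true false j ω

/-- `q_{2,j} = r^{1,1}_j + r^{0,1}_j`. -/
def q₂ (j : ℕ) (ω : Ω) : ℝ := S.r true true j ω + S.r false true j ω

/-- The false identification cost `1 - max {q_{1,τ₁}, q_{2,τ₁}}`, which is almost surely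
nonnegative. Its value where `τ₁ = ∞` is immaterial, because the cost is infinite there. -/
def errorCost (τ₁ : S.RefineTime) (ω : Ω) : ℝ≥0∞ :=
  ENNReal.ofReal (1 - max (S.q₁ (τ₁.1 ω).toNat ω) (S.q₂ (τ₁.1 ω).toNat ω))

/-- `v(τ₀, φ) = ess inf_{τ₁} E[c τ₁ + 1 - max {q_{1,τ₁}, q_{2,τ₁}} | F_{τ₀}]`. -/
def refineValue [IsFiniteMeasure P] (c : ℝ) : Ω → ℝ≥0∞ :=
  essInfFamily P
    (fun τ₁ : S.RefineTime =>
      P⁻[fun ω => ENNReal.ofReal c * (τ₁.1 ω : ℝ≥0∞) + S.errorCost τ₁ ω | S.stoppedSigma])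
    (fun _ => measurable_condLExp' _ _ _)

end ScanPolicy

/-! ### The two optimisation problems -/

/-- `w₀ = inf_{τ₀, φ, τ₁} E[c (τ₀ + τ₁) + 1 - max {q_{1,τ₁}, q_{2,τ₁}}]`. -/
def jointValue (c : ℝ) : ℝ≥0∞ :=
  ⨅ (S : M.ScanPolicy) (τ₁ : S.RefineTime),
    ∫⁻ ω, (ENNReal.ofReal c * ((S.τ₀ ω : ℝ≥0∞) + (τ₁.1 ω : ℝ≥0∞)) + S.errorCost τ₁ ω) ∂P

/-- `u₀ = inf_{τ₀, φ} E[c τ₀ + v(τ₀, φ)]`. -/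
def concatenatedValue [IsFiniteMeasure P] (c : ℝ) : ℝ≥0∞ :=
  ⨅ S : M.ScanPolicy, ∫⁻ ω, (ENNReal.ofReal c * (S.τ₀ ω : ℝ≥0∞) + S.refineValue c ω) ∂P

end Sequences

end QuickestSearch

end

open MeasureTheory ProbabilityTheory
open scoped ENNReal

namespace QuickestSearch

/-! Fix a scanning policy. Its cost `c τ₀` does not depend on `τ₁`, so the claim reduces to an
interchange of expectation and essential infimum: E[v] is the infimum over `τ₁` of the expected
refinement cost (`lintegral_refineValue`). One inequality is the tower property, as v lies almost
surely below every conditional cost.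

The other holds because the conditional costs are downward directed: of two refinement times, follow
the one with the smaller conditional cost. This choice is known at `τ₀`, so the pasted time is again
a stopping time, and its conditional cost is the minimum of the two (`condLExp_piecewise`).
Directedness yields a decreasing sequence of costs that reaches the essential infimum, and monotone
convergence applies because stopping at once has finite cost (`IsEssInf.iInf_lintegral_le`). -/

/-- Conditional expectation commutes with pasting along an event of the conditioning σ-algebra. -/
theorem condLExp_piecewise {Ω : Type*} {m mΩ : MeasurableSpace Ω} {P : Measure[mΩ] Ω}
    [IsFiniteMeasure P] (hm : m ≤ mΩ) (X Y : Ω → ℝ≥0∞) {A : Set Ω} [DecidablePred (· ∈ A)]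
    (hA : MeasurableSet[m] A) :
    A.piecewise P⁻[X|m] P⁻[Y|m] =ᵐ[P] P⁻[A.piecewise X Y|m] := by
  have split : ∀ f g : Ω → ℝ≥0∞, ∀ s, MeasurableSet[m] s →
      ∫⁻ ω in s, A.piecewise f g ω ∂P = ∫⁻ ω in s ∩ A, f ω ∂P + ∫⁻ ω in s \ A, g ω ∂P := by
    intro f g s hs
    rw [← lintegral_inter_add_sdiff _ s (hm _ hA)]
    congr 1
    · exact setLIntegral_congr_fun (hm _ (hs.inter hA)) fun ω hω =>
        Set.piecewise_eq_of_mem _ _ _ hω.2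
    · exact setLIntegral_congr_fun (hm _ (hs.diff hA)) fun ω hω =>
        Set.piecewise_eq_of_notMem _ _ _ hω.2
  refine ae_eq_condLExp hm P _
    ((measurable_condLExp m P X).piecewise hA (measurable_condLExp m P Y)) fun s hs => ?_
  rw [split _ _ s hs, split _ _ s hs, setLIntegral_condLExp hm P X (hs.inter hA),
    setLIntegral_condLExp hm P Y (hs.diff hA)]

/-- For a downward directed family, one of whose members has a finite integral, the infimum of the
integrals is at most the integral of the essential infimum. -/
theorem IsEssInf.iInf_lintegral_le {Ω : Type*} [MeasurableSpace Ω] {ι : Type*} {P : Measure Ω}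
    {Φ : ι → Ω → ℝ≥0∞} {v : Ω → ℝ≥0∞} (hv : IsEssInf P Φ v) (hΦ : ∀ i, Measurable (Φ i))
    (hdir : ∀ i j, ∃ k, Φ k ≤ᵐ[P] Φ i ∧ Φ k ≤ᵐ[P] Φ j) (hfin : ∃ i, ∫⁻ ω, Φ i ω ∂P ≠ ⊤) :
    ⨅ i, ∫⁻ ω, Φ i ω ∂P ≤ ∫⁻ ω, v ω ∂P := by
  obtain ⟨i₀, hi₀⟩ := hfin
  obtain ⟨s, -, hs, hmem⟩ := exists_seq_tendsto_sInf
    (Set.range_nonempty_iff_nonempty.2 ⟨i₀⟩ : (Set.range fun i => ∫⁻ ω, Φ i ω ∂P).Nonempty)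
    (OrderBot.bddBelow _)
  choose a ha using hmem
  choose meet hmeet_left hmeet_right using hdir
  -- Running meets of a minimizing sequence. Starting at `i₀` gives the finite integral that
  -- decreasing monotone convergence needs.
  let b : ℕ → ι := fun n => Nat.rec i₀ (fun k i => meet i (a k)) n
  have hb : ∀ n, Φ (b (n + 1)) ≤ᵐ[P] Φ (b n) := fun n => hmeet_left _ _
  have hu_meas : Measurable fun ω => ⨅ n, Φ (b n) ω := Measurable.iInf fun n => hΦ _
  have hu_le : ∫⁻ ω, ⨅ n, Φ (b n) ω ∂P ≤ ⨅ i, ∫⁻ ω, Φ i ω ∂P := by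
    refine ge_of_tendsto' hs fun n => ?_
    rw [← ha n]
    calc ∫⁻ ω, ⨅ k, Φ (b k) ω ∂P
        ≤ ∫⁻ ω, Φ (b (n + 1)) ω ∂P := lintegral_mono fun ω => iInf_le _ (n + 1)
      _ ≤ ∫⁻ ω, Φ (a n) ω ∂P := lintegral_mono_ae (hmeet_right _ _)
  -- Each minimum dominates a member of the family, namely a meet, so its integral is at least the
  -- infimum; this survives the decreasing limit.
  have hmin_ge : ∀ i, ⨅ i, ∫⁻ ω, Φ i ω ∂P ≤ ∫⁻ ω, ⨅ n, min (Φ (b n) ω) (Φ i ω) ∂P := fun i => by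
    rw [lintegral_iInf_ae (fun n => (hΦ _).min (hΦ i))]
    · refine le_iInf fun n => (iInf_le _ (meet (b n) i)).trans (lintegral_mono_ae ?_)
      filter_upwards [hmeet_left (b n) i, hmeet_right (b n) i] with ω h₁ h₂
      exact le_min h₁ h₂
    · intro n
      filter_upwards [hb n] with ω h
      exact min_le_min_right _ h
    · exact ((lintegral_mono fun ω => min_le_left _ _).trans_lt hi₀.lt_top).ne
  -- Taking the minimum with `Φ i` cannot lower the integral of the limit, which is already at most
  -- the infimum. So it changes the limit only on a null set.
  have hu : ∀ i, (fun ω => ⨅ n, Φ (b n) ω) ≤ᵐ[P] Φ i := fun i => by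
    have hle : (fun ω => ⨅ n, min (Φ (b n) ω) (Φ i ω)) ≤ᵐ[P] fun ω => ⨅ n, Φ (b n) ω :=
      Filter.Eventually.of_forall fun ω => iInf_mono fun n => min_le_left _ _
    have hne : ∫⁻ ω, ⨅ n, min (Φ (b n) ω) (Φ i ω) ∂P ≠ ⊤ :=
      ((lintegral_mono fun ω => (iInf_le (fun n => min (Φ (b n) ω) (Φ i ω)) 0).trans
        (min_le_left _ _)).trans_lt hi₀.lt_top).ne
    filter_upwards [ae_eq_of_ae_le_of_lintegral_le hle hne hu_meas.aemeasurable
      (hu_le.trans (hmin_ge i))] with ω h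
    exact h.ge.trans ((iInf_le _ 0).trans (min_le_right _ _))
  calc ⨅ i, ∫⁻ ω, Φ i ω ∂P
      ≤ ∫⁻ ω, ⨅ n, min (Φ (b n) ω) (Φ i₀ ω) ∂P := hmin_ge i₀
    _ ≤ ∫⁻ ω, ⨅ n, Φ (b n) ω ∂P := lintegral_mono fun ω => iInf_mono fun n => min_le_left _ _
    _ ≤ ∫⁻ ω, v ω ∂P := lintegral_mono_ae (hv.greatest _ hu_meas hu)

namespace Sequences.ScanPolicy

variable {Ω : Type*} [mΩ : MeasurableSpace Ω] {P : Measure Ω} {P₀ P₁ : Measure ℝ} {π₀ : ℝ}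
  {M : Sequences P P₀ P₁ π₀} (S : M.ScanPolicy)

/-- The cost `c τ₁ + 1 - max {q_{1,τ₁}, q_{2,τ₁}}` of the refinement stage. -/
noncomputable def refineCost (c : ℝ) (τ₁ : S.RefineTime) (ω : Ω) : ℝ≥0∞ :=
  ENNReal.ofReal c * (τ₁.1 ω : ℝ≥0∞) + S.errorCost τ₁ ω

/-- The stopping time that ends the refinement stage at once. -/
def zeroTime : S.RefineTime := ⟨fun _ => 0, isStoppingTime_const _ 0⟩

/-- The stopping time that follows `σ` on an event `A` of `F_{τ₀}`, and `τ` off it. -/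
noncomputable def pasteTime {A : Set Ω} (hA : MeasurableSet[S.stoppedSigma] A)
    (σ τ : S.RefineTime) : S.RefineTime :=
  open Classical in
  -- Both times are at least 0, and `A` already belongs to the σ-algebra at time 0 of the refinement
  -- filtration.
  ⟨A.piecewise σ.1 τ.1, σ.2.piecewise_of_le (i := 0) τ.2 (fun _ => zero_le) (fun _ => zero_le)
    ((le_sup_left : S.stoppedSigma ≤ S.refineFiltration 0) _ hA)⟩

/-- The posteriors do not depend on the stopping time, so the cost at `ω` depends on it only through
its value at `ω`. -/
theorem refineCost_pasteTime (c : ℝ) {A : Set Ω} [DecidablePred (· ∈ A)]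
    (hA : MeasurableSet[S.stoppedSigma] A) (σ τ : S.RefineTime) :
    S.refineCost c (S.pasteTime hA σ τ) = A.piecewise (S.refineCost c σ) (S.refineCost c τ) := by
  ext ω
  by_cases h : ω ∈ A <;> simp [refineCost, errorCost, pasteTime, h]

variable [IsProbabilityMeasure P]

/-- The conditional refinement costs given `F_{τ₀}` are downward directed. -/
theorem exists_condLExp_refineCost_le (c : ℝ) (σ τ : S.RefineTime) :
    ∃ ρ : S.RefineTime,
      P⁻[S.refineCost c ρ|S.stoppedSigma] ≤ᵐ[P] P⁻[S.refineCost c σ|S.stoppedSigma] ∧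
      P⁻[S.refineCost c ρ|S.stoppedSigma] ≤ᵐ[P] P⁻[S.refineCost c τ|S.stoppedSigma] := by
  classical
  let f := P⁻[S.refineCost c σ|S.stoppedSigma]
  let g := P⁻[S.refineCost c τ|S.stoppedSigma]
  have hA : MeasurableSet[S.stoppedSigma] {ω | f ω ≤ g ω} :=
    @measurableSet_le _ _ _ _ _ S.stoppedSigma _ _ _ _ _
      (measurable_condLExp _ _ _) (measurable_condLExp _ _ _)
  have h := condLExp_piecewise (P := P) S.stoppedSigma_le (S.refineCost c σ) (S.refineCost c τ) hA
  rw [← S.refineCost_pasteTime c hA σ τ] at h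
  have hmin : {ω | f ω ≤ g ω}.piecewise f g = fun ω => min (f ω) (g ω) := by
    ext ω
    simp [Set.piecewise, min_def]
  change {ω | f ω ≤ g ω}.piecewise f g =ᵐ[P] _ at h
  rw [hmin] at h
  refine ⟨S.pasteTime hA σ τ, ?_, ?_⟩
  · filter_upwards [h] with ω hω
    exact hω.ge.trans (min_le_left _ _)
  · filter_upwards [h] with ω hω
    exact hω.ge.trans (min_le_right _ _)

/-- Stopping the refinement stage at once has a finite expected cost. -/
theorem lintegral_refineCost_zeroTime_ne_top (c : ℝ) :
    ∫⁻ ω, S.refineCost c S.zeroTime ω ∂P ≠ ⊤ := by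
  -- Dropping `q₂` from the maximum only raises the cost, and leaves the positive part of an
  -- integrable function.
  have hint : Integrable (fun ω => 1 - S.q₁ 0 ω) P :=
    (integrable_const 1).sub (integrable_condExp.add integrable_condExp)
  refine ((lintegral_mono fun ω => ?_).trans_lt hint.lintegral_lt_top).ne
  simp only [refineCost, errorCost, zeroTime, ENat.toENNReal_zero, mul_zero, zero_add, ENat.toNat_zero]
  exact ENNReal.ofReal_le_ofReal (sub_le_sub_left (le_max_left _ _) _)

/-- The refinement stage can be optimised conditionally on `F_{τ₀}`. -/
theorem lintegral_refineValue (c : ℝ) :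
    ∫⁻ ω, S.refineValue c ω ∂P = ⨅ τ₁ : S.RefineTime, ∫⁻ ω, S.refineCost c τ₁ ω ∂P := by
  have htower : ∀ τ₁ : S.RefineTime, ∫⁻ ω, P⁻[S.refineCost c τ₁|S.stoppedSigma] ω ∂P =
      ∫⁻ ω, S.refineCost c τ₁ ω ∂P := fun τ₁ => lintegral_condLExp S.stoppedSigma_le P _
  have hv : IsEssInf P (fun τ₁ : S.RefineTime => P⁻[S.refineCost c τ₁|S.stoppedSigma])
      (S.refineValue c) := isEssInf_essInfFamily _ _ _
  simp only [← htower]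
  refine le_antisymm (le_iInf fun τ₁ => lintegral_mono_ae (hv.le τ₁))
    (hv.iInf_lintegral_le (fun _ => measurable_condLExp' _ _ _)
      (S.exists_condLExp_refineCost_le c) ⟨S.zeroTime, ?_⟩)
  rw [htower]
  exact S.lintegral_refineCost_zeroTime_ne_top c

end Sequences.ScanPolicy

end QuickestSearch

theorem mainTheorem2 {Ω : Type*} [MeasurableSpace Ω] (P : Measure Ω) [IsProbabilityMeasure P]
    (P₀ P₁ : Measure ℝ) [IsProbabilityMeasure P₀] [IsProbabilityMeasure P₁]
    (hP₀_density : P₀ ≪ volume) (hP₁_density : P₁ ≪ volume)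
    (hP₀P₁ : P₀ ≪ P₁) (hP₁P₀ : P₁ ≪ P₀) (hne : P₀ ≠ P₁)
    (π₀ : ℝ) (hπ₀ : π₀ ∈ Set.Icc (0 : ℝ) 1) (c : ℝ) (hc : 0 < c)
    (M : QuickestSearch.Sequences P P₀ P₁ π₀) :
    M.jointValue c = M.concatenatedValue c := by
  refine iInf_congr fun S => ?_
  have hτ₀ : Measurable fun ω => ENNReal.ofReal c * (S.τ₀ ω : ℝ≥0∞) :=
    ((measurable_of_countable (α := WithTop ℕ) fun n => ENat.toENNReal n).comp
      S.isStoppingTime.measurable').const_mul _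
  have : Nonempty S.RefineTime := ⟨S.zeroTime⟩
  -- In `[0,∞]` the scanning cost passes through the infimum even when its expectation is infinite.
  rw [lintegral_add_left hτ₀, S.lintegral_refineValue c, ENNReal.add_iInf]
  refine iInf_congr fun τ₁ => ?_
  rw [← lintegral_add_left hτ₀]
  refine lintegral_congr fun ω => ?_
  rw [QuickestSearch.Sequences.ScanPolicy.refineCost, mul_add, add_assoc]
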